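/- Let $X$ be a compact metrizable space and let $d$ be any metric inducing its topology. Let $O_X$ be the set of points of $X$ having a neighborhood homeomorphic to $(0,1)$, let $S_X$ be the set of points having a clopen neighborhood homeomorphic to the circle $S^1$, and put $C=C_X=X\setminus O_X$. Let $H(X)$ be the group of homeomorphisms of $X$ onto itself and $\tau_k$ the compact-open topology on $H(X)$. For $\epsilon>0$ let $C_\epsilon=\{x\in X: d(x,C)<\epsilon\}$ (so $C_\epsilon=\emptyset$ if $C=\emptyset$), let $$B_\epsilon=\{h\in H(X): d(h(x),x)<\epsilon \text{ and } d(h^{-1}(x),x)<\epsilon \text{ for all } x\in X\setminus C_\epsilon\},$$ and let $\tau_{k|C}$ be the collection of all unions of left translates $fB_\epsilon$ ($f\in H(X)$, $\epsilon>0$). Suppose that $O_X$ is dense in $X$, that $S_X$ has at most one limit point in $C$ (that is, $|\overline{S_X}\cap C|\le 1$), and that one of the following holds: (a) $C$ is zero-dimensional (its clopen subsets form a base) and $X\setminus S_X$ has only finitely many connected components; or (b) $C$ is a convergent sequence, that is, $C=\{c\}\cup\{c_n:n\in\mathbb N\}$ with $c,c_0,c_1,\dots$ pairwise distinct and $c_n\to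 c$. Then $\tau_{k|C}=\tau_k$, and $\tau_k$ is the minimum Hausdorff group topology on $H(X)$ (it is a Hausdorff group topology contained in every Hausdorff group topology on $H(X)$). In particular $\tau_k$ is a minimal Hausdorff group topology: no strictly coarser group topology on $H(X)$ is Hausdorff. -/

import Mathlib

open Set Filter Topology

namespace HomeoTop

section Spaces

variable (X : Type*) [TopologicalSpace X]

/-- The one-manifold part `O_X`: the points having a neighborhood homeomorphic to `(0,1)`. -/
def oneManifoldPart : Set X :=
  {x | ∃ U ∈ 𝓝 x, Nonempty (U ≃ₜ Ioo (0 : ℝ) 1)}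

/-- `S_X`: the points having a clopen neighborhood homeomorphic to the circle. -/
def circlePart : Set X :=
  {x | ∃ U ∈ 𝓝 x, IsClopen U ∧ Nonempty (U ≃ₜ Circle)}

/-- `C_X = X \ O_X`. -/
def singularPart : Set X := (oneManifoldPart X)ᶜ

end Spaces

/-- A space is zero-dimensional when its clopen sets form a base. -/
def IsZeroDimensional (Y : Type*) [TopologicalSpace Y] : Prop :=
  TopologicalSpace.IsTopologicalBasis {s : Set Y | IsClopen s}

/-- `C` is a (nontrivial) convergent sequence: it consists of the terms of a sequence of distinct
points together with its limit, which is none of the terms. -/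
def IsConvergentSequence {X : Type*} [TopologicalSpace X] (C : Set X) : Prop :=
  ∃ (c : X) (u : ℕ → X), Function.Injective u ∧ c ∉ range u ∧ Tendsto u atTop (𝓝 c) ∧
    C = insert c (range u)

/-- The compact-open topology `τ_k` on the group `H(X)` of homeomorphisms of `X`: the topology
inherited from the compact-open topology on `C(X, X)`. -/
@[reducible]
def compactOpenTopology (X : Type*) [TopologicalSpace X] : TopologicalSpace (X ≃ₜ X) :=
  TopologicalSpace.induced (fun h : X ≃ₜ X => (h : C(X, X))) ContinuousMap.compactOpen

/-- `B_ε = {h ∈ H(X) : d(h(x), x) < ε and d(h⁻¹(x), x) < ε for all x ∉ C_ε}`, where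
`C_ε = {x : d(x, C) < ε}` (which is empty when `C` is empty). -/
def shrunkBall {X : Type*} [MetricSpace X] (C : Set X) (ε : ℝ) : Set (X ≃ₜ X) :=
  {h | ∀ x ∉ Metric.thickening ε C, dist (h x) x < ε ∧ dist (h.symm x) x < ε}

/-- `τ_{k|C}`: the collection of all unions of (left) translates of the sets `B_ε`, `ε > 0`. -/
def shrunkOpens {X : Type*} [MetricSpace X] (C : Set X) : Set (Set (X ≃ₜ X)) :=
  {U | ∃ 𝒮 : Set (Set (X ≃ₜ X)),
    (∀ V ∈ 𝒮, ∃ (f : X ≃ₜ X) (ε : ℝ), 0 < ε ∧ V = (fun g => f * g) '' shrunkBall C ε) ∧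
    U = ⋃₀ 𝒮}

section Groups

variable {G : Type*} [Group G]

/-- `t` is a Hausdorff topological group topology on `G`. -/
def IsHausdorffGroupTopology (t : TopologicalSpace G) : Prop :=
  @IsTopologicalGroup G t _ ∧ @T2Space G t

/-- `t` is a Hausdorff group topology contained in every Hausdorff group topology. -/
def IsMinimumGroupTopology (t : TopologicalSpace G) : Prop :=
  IsHausdorffGroupTopology t ∧
    ∀ s : TopologicalSpace G, IsHausdorffGroupTopology s →
      {U : Set G | IsOpen[t] U} ⊆ {U : Set G | IsOpen[s] U}

/-- `t` is a Hausdorff group topology such that no strictly coarser group topology is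
Hausdorff. -/
def IsMinimalGroupTopology (t : TopologicalSpace G) : Prop :=
  IsHausdorffGroupTopology t ∧
    ∀ s : TopologicalSpace G, IsHausdorffGroupTopology s →
      ¬ ({U : Set G | IsOpen[s] U} ⊂ {U : Set G | IsOpen[t] U})

end Groups

end HomeoTop

/-! The sets `shrunkBall` lie between `τ_k` and any Hausdorff group topology `s`: each is an
`s`-neighborhood of the identity, and together they form a base at the identity for `τ_k`. Left
translation then gives `τ_k ⊆ s`.

The first half uses only compactness of `X`. For non-commuting `f`, `g` supported in an open arc,
the `h` such that `h f h⁻¹` and `g` do not commute form an `s`-open set containing the identity, and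
such an `h` cannot move the arc off itself (`arc_meets_image_mem_nhds`). Small arcs flanking a point
on both sides then trap the image of the segment between them, and compactness of the complement of
`C_ε` finishes (`shrunkBall_mem_nhds`).

The second half is `exists_shrunkBall_forall_dist_lt`. If it fails, homeomorphisms `h n` tending to
the identity locally uniformly off `C` move points `x n → a` to points tending to some `b ≠ a`, with
`a`, `b` in `C`. Closed parts of `C` around `a` and `b` are separated by finite subsets of `O_X`. If
connected sets near the part of `a` join `x n` to a fixed finite set of anchors in `O_X`, their
images are trapped on the side of `a`, because `h n` barely moves the anchors and the separating
points (`TendstoIdOffSingular.false_of_finite_anchors`). Boundary bumping supplies anchors unless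
the component of `x n` stays near that part. In case (a) only finitely many components occur, so one
anchor in each suffices. In case (b), with `a` isolated in `C`, such a component contains `a` or is
a compact connected one-manifold, hence a circle (`nonempty_homeomorph_circle`); the hypothesis on
`S_X` excludes circles. -/

namespace HomeoTop

/-! ### Compact connected one-manifolds are circles -/

/-- Every point of the space is the center of an open arc. -/
def IsOneManifold (D : Type*) [TopologicalSpace D] : Prop :=
  ∀ p : D, ∃ ι : ℝ → D, IsOpenEmbedding ι ∧ ι 0 = p

/-- Injectivity near every point. -/
def LocallyInjective {D : Type*} (γ : ℝ → D) : Prop :=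
  ∀ t, ∃ U ∈ 𝓝 t, InjOn γ U

/-- The curve that follows `f` up to time `0` and `g` afterwards. -/
noncomputable def glueCurves {D : Type*} (f g : ℝ → D) (t : ℝ) : D :=
  if t ≤ 0 then f t else g t

/-- A connected set that meets an open subarc and misses its endpoints lies in the subarc. -/
theorem subset_image_Ioo_of_isPreconnected {D : Type*} [TopologicalSpace D] [T2Space D]
    {ι : ℝ → D} (hι : IsOpenEmbedding ι) {a b : ℝ} {A : Set D} (hA : IsPreconnected A)
    (hne : (A ∩ ι '' Ioo a b).Nonempty) (ha : ι a ∉ A) (hb : ι b ∉ A) : A ⊆ ι '' Ioo a b := by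
  refine hA.subset_of_closure_inter_subset (hι.isOpenMap _ isOpen_Ioo) hne ?_
  rintro x ⟨hx, hxA⟩
  have hcl : closure (ι '' Ioo a b) ⊆ ι '' Icc a b :=
    closure_minimal (image_mono Ioo_subset_Icc_self)
      (isCompact_Icc.image hι.continuous).isClosed
  obtain ⟨t, ht, rfl⟩ := hcl hx
  refine ⟨t, ⟨lt_of_le_of_ne ht.1 ?_, lt_of_le_of_ne ht.2 ?_⟩, rfl⟩
  · rintro rfl; exact ha hxA
  · rintro rfl; exact hb hxA

/-- Invariance of domain in dimension one: injectivity forces strict monotonicity, and the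
intermediate value theorem fills the interval. -/
theorem image_Icc_mem_nhds_of_injOn {T : ℝ → ℝ} {a b t : ℝ} (ht : t ∈ Ioo a b)
    (hc : ContinuousOn T (Icc a b)) (hi : InjOn T (Icc a b)) : T '' Icc a b ∈ 𝓝 (T t) := by
  have hab : a ≤ b := (ht.1.trans ht.2).le
  have ht' : t ∈ Icc a b := Ioo_subset_Icc_self ht
  rcases hc.strictMonoOn_of_injOn_Icc' hab hi with h | h
  · exact mem_of_superset (Icc_mem_nhds (h (left_mem_Icc.2 hab) ht' ht.1)
      (h ht' (right_mem_Icc.2 hab) ht.2)) (intermediate_value_Icc hab hc)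
  · exact mem_of_superset (Icc_mem_nhds (h ht' (right_mem_Icc.2 hab) ht.2)
      (h (left_mem_Icc.2 hab) ht' ht.1)) (intermediate_value_Icc' hab hc)

/-- A curve reads as a real function in a chart. -/
theorem exists_chart_lift {D : Type*} [TopologicalSpace D] {κ : ℝ → D} (hκ : IsOpenEmbedding κ)
    {γ : ℝ → D} {A : Set ℝ} (hγ : ContinuousOn γ A) (hA : MapsTo γ A (range κ)) :
    ∃ T : ℝ → ℝ, ContinuousOn T A ∧ ∀ u ∈ A, κ (T u) = γ u := by
  let e := hκ.toOpenPartialHomeomorph κ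
  refine ⟨fun u => e.symm (γ u), ?_, ?_⟩
  · refine e.continuousOn_symm.comp hγ ?_
    simpa [e] using hA
  · intro u hu
    have : γ u ∈ e.target := by simpa [e] using hA hu
    simpa [e] using e.right_inv this

theorem LocallyInjective.isOpenMap {D : Type*} [TopologicalSpace D] (hD : IsOneManifold D)
    {γ : ℝ → D} (hγ : Continuous γ) (hi : LocallyInjective γ) : IsOpenMap γ := by
  refine IsOpenMap.of_nhds_le fun t => ?_
  intro S hS
  obtain ⟨κ, hκ, hκ0⟩ := hD (γ t)
  obtain ⟨U, hU, hUi⟩ := hi t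
  have hV : γ ⁻¹' range κ ∈ 𝓝 t :=
    hγ.continuousAt.preimage_mem_nhds (hκ.isOpen_range.mem_nhds ⟨0, hκ0⟩)
  obtain ⟨δ, hδ, hsub⟩ := Metric.nhds_basis_closedBall.mem_iff.1
    (inter_mem (inter_mem hU hV) (mem_map.1 hS))
  rw [Real.closedBall_eq_Icc] at hsub
  obtain ⟨T, hT, hTγ⟩ := exists_chart_lift hκ hγ.continuousOn (fun u hu => (hsub hu).1.2)
  have ht : t ∈ Ioo (t - δ) (t + δ) := ⟨by linarith, by linarith⟩
  have hTi : InjOn T (Icc (t - δ) (t + δ)) := by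
    intro u hu v hv huv
    refine hUi (hsub hu).1.1 (hsub hv).1.1 ?_
    rw [← hTγ u hu, ← hTγ v hv, huv]
  have := hκ.isOpenMap.image_mem_nhds (image_Icc_mem_nhds_of_injOn ht hT hTi)
  rw [hTγ t (Ioo_subset_Icc_self ht)] at this
  refine mem_of_superset this ?_
  rintro _ ⟨_, ⟨u, hu, rfl⟩, rfl⟩
  rw [hTγ u hu]
  exact (hsub hu).2

theorem continuous_glueCurves {D : Type*} [TopologicalSpace D] {f g : ℝ → D} (hf : Continuous f)
    (hg : Continuous g) (h0 : f 0 = g 0) : Continuous (glueCurves f g) := by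
  refine Continuous.if_le hf hg continuous_id continuous_const ?_
  rintro x rfl
  exact h0

theorem range_glueCurves {D : Type*} {f g : ℝ → D} (h0 : f 0 = g 0) :
    range (glueCurves f g) = f '' Iic 0 ∪ g '' Ici 0 := by
  ext x
  constructor
  · rintro ⟨t, rfl⟩
    by_cases ht : t ≤ 0
    · exact Or.inl ⟨t, ht, by simp [glueCurves, ht]⟩
    · exact Or.inr ⟨t, (not_le.1 ht).le, by simp [glueCurves, ht]⟩
  · rintro (⟨t, ht, rfl⟩ | ⟨t, ht, rfl⟩)
    · exact ⟨t, by simp [glueCurves, mem_Iic.1 ht]⟩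
    · rcases (mem_Ici.1 ht).eq_or_lt with rfl | ht
      · exact ⟨0, by simp [glueCurves, h0]⟩
      · exact ⟨t, by simp [glueCurves, ht]⟩

theorem locallyInjective_glueCurves {D : Type*} {f g : ℝ → D} (hf : Function.Injective f)
    (hg : Function.Injective g) {δ : ℝ} (hδ : 0 < δ)
    (h : ∀ u ∈ Icc (-δ) 0, ∀ v ∈ Ioc 0 δ, f u ≠ g v) : LocallyInjective (glueCurves f g) := by
  intro t
  rcases lt_trichotomy t 0 with ht | rfl | ht
  · refine ⟨Iio 0, Iio_mem_nhds ht, fun u hu v hv huv => hf ?_⟩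
    simpa [glueCurves, (mem_Iio.1 hu).le, (mem_Iio.1 hv).le] using huv
  · refine ⟨Icc (-δ) δ, Icc_mem_nhds (by linarith) hδ, fun u hu v hv huv => ?_⟩
    rcases le_or_gt u 0 with hu0 | hu0 <;> rcases le_or_gt v 0 with hv0 | hv0
    · exact hf (by simpa [glueCurves, hu0, hv0] using huv)
    · exact (h u ⟨hu.1, hu0⟩ v ⟨hv0, hv.2⟩
        (by simpa [glueCurves, hu0, hv0.not_ge] using huv)).elim
    · exact (h v ⟨hv.1, hv0⟩ u ⟨hu0, hu.2⟩
        (by simpa [glueCurves, hv0, hu0.not_ge] using huv.symm)).elim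
    · exact hg (by simpa [glueCurves, hu0.not_ge, hv0.not_ge] using huv)
  · refine ⟨Ioi 0, Ioi_mem_nhds ht, fun u hu v hv huv => hg ?_⟩
    simpa [glueCurves, (mem_Ioi.1 hu).not_ge, (mem_Ioi.1 hv).not_ge] using huv

theorem glueCurves_ne {D : Type*} {f g : ℝ → D} (h : Function.Injective (glueCurves f g))
    {u v : ℝ} (hu : u ≤ 0) (hv : 0 < v) : f u ≠ g v := by
  intro huv
  have : glueCurves f g u = glueCurves f g v := by simpa [glueCurves, hu, hv.not_ge] using huv
  exact (hu.trans_lt hv).ne (h this)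

/-- Two arcs through the same point can be glued both ways, after reversing one of them if
necessary. -/
theorem exists_compatible_orientation {D : Type*} [TopologicalSpace D] {ι κ : ℝ → D}
    (hι : IsOpenEmbedding ι) (hκ : IsOpenEmbedding κ) (h0 : ι 0 = κ 0) :
    ∃ ι' : ℝ → D, IsOpenEmbedding ι' ∧ range ι' = range ι ∧ ι' 0 = κ 0 ∧
      LocallyInjective (glueCurves ι' κ) ∧ LocallyInjective (glueCurves κ ι') := by
  have hV : ι ⁻¹' range κ ∈ 𝓝 (0 : ℝ) :=
    hι.continuous.continuousAt.preimage_mem_nhds (hκ.isOpen_range.mem_nhds ⟨0, h0.symm⟩)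
  obtain ⟨δ, hδ, hsub⟩ := Metric.nhds_basis_closedBall.mem_iff.1 hV
  rw [Real.closedBall_eq_Icc, zero_sub, zero_add] at hsub
  obtain ⟨T, hT, hTι⟩ := exists_chart_lift hκ hι.continuous.continuousOn hsub
  have hTi : InjOn T (Icc (-δ) δ) := by
    intro u hu v hv huv
    refine hι.injective ?_
    rw [← hTι u hu, ← hTι v hv, huv]
  have mem0 : (0 : ℝ) ∈ Icc (-δ) δ := ⟨by linarith, hδ.le⟩
  have hT0 : T 0 = 0 := hκ.injective (by rw [hTι 0 mem0, h0])
  -- Read in the chart `κ`, the arc `ι` is strictly monotone near `0`. If increasing, the two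
  -- orientations agree; if decreasing, `ι` is reversed.
  rcases hT.strictMonoOn_of_injOn_Icc' (by linarith) hTi with hm | hm
  · refine ⟨ι, hι, rfl, h0, locallyInjective_glueCurves hι.injective hκ.injective hδ ?_,
      locallyInjective_glueCurves hκ.injective hι.injective hδ ?_⟩
    · intro u hu v hv huv
      have hu' : u ∈ Icc (-δ) δ := ⟨hu.1, hu.2.trans hδ.le⟩
      have h1 : T u = v := hκ.injective (by rw [hTι u hu', huv])
      have h2 := hm.monotoneOn hu' mem0 hu.2
      linarith [hv.1]
    · intro u hu v hv huv
      have hv' : v ∈ Icc (-δ) δ := ⟨by linarith [hv.1], hv.2⟩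
      have h1 : T v = u := hκ.injective (by rw [hTι v hv', huv])
      have h2 := hm mem0 hv' hv.1
      linarith [hu.2]
  · have hneg : IsOpenEmbedding (fun t : ℝ => ι (-t)) :=
      hι.comp (Homeomorph.neg ℝ).isOpenEmbedding
    refine ⟨fun t => ι (-t), hneg, ?_, by simpa using h0,
      locallyInjective_glueCurves hneg.injective hκ.injective hδ ?_,
      locallyInjective_glueCurves hκ.injective hneg.injective hδ ?_⟩
    · exact (Homeomorph.neg ℝ).surjective.range_comp ι
    · intro u hu v hv huv
      have hu' : -u ∈ Icc (-δ) δ := ⟨by linarith [hu.2], by linarith [hu.1]⟩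
      have h1 : T (-u) = v := hκ.injective (by rw [hTι _ hu', huv])
      have h2 := hm.antitoneOn mem0 hu' (by linarith [hu.2])
      linarith [hv.1]
    · intro u hu v hv huv
      have hv' : -v ∈ Icc (-δ) δ := ⟨by linarith [hv.2], by linarith [hv.1]⟩
      have h1 : T (-v) = u := hκ.injective (by rw [hTι _ hv', huv])
      have h2 := hm hv' mem0 (by linarith [hv.1])
      linarith [hu.2]

/-- If each half-arc has a point off the other, the initial segment of `ι` up to its missing point
is caught in a bounded piece of `κ`. It cannot leave past the missing point of `κ`, nor backwards by
`hdisj`. -/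
theorem image_Ici_subset_or_subset {D : Type*} [TopologicalSpace D] [T2Space D] {ι κ : ℝ → D}
    (hι : Continuous ι) (hκ : IsOpenEmbedding κ) (h0 : ι 0 = κ 0)
    (hdisj : ∀ t > 0, ∀ s < 0, ι t ≠ κ s) :
    ι '' Ici 0 ⊆ κ '' Ici 0 ∨ κ '' Ici 0 ⊆ ι '' Ici 0 := by
  by_contra! hcon
  obtain ⟨h1, h2⟩ := hcon
  obtain ⟨_, ⟨t₁, ht₁, rfl⟩, ht⟩ := not_subset.1 h1
  obtain ⟨_, ⟨s₁, hs₁, rfl⟩, hs⟩ := not_subset.1 h2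
  have hs0 : 0 < s₁ := by
    refine lt_of_le_of_ne hs₁ ?_
    rintro rfl
    exact hs ⟨0, self_mem_Ici, h0⟩
  have ht0 : 0 < t₁ := by
    refine lt_of_le_of_ne ht₁ ?_
    rintro rfl
    exact ht ⟨0, self_mem_Ici, h0.symm⟩
  have hsub : ι '' Icc 0 t₁ ⊆ κ '' Ioo (-1) s₁ := by
    refine subset_image_Ioo_of_isPreconnected hκ (isPreconnected_Icc.image _ hι.continuousOn)
      ⟨ι 0, ⟨0, ⟨le_rfl, ht₁⟩, rfl⟩, 0, ⟨by norm_num, hs0⟩, h0.symm⟩ ?_ ?_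
    · rintro ⟨t, ht, htκ⟩
      rcases ht.1.eq_or_lt with rfl | htp
      · have := hκ.injective (h0.symm.trans htκ)
        norm_num at this
      · exact hdisj t htp (-1) (by norm_num) htκ
    · rintro ⟨t, ht, htκ⟩
      exact hs ⟨t, ht.1, htκ⟩
  obtain ⟨s, _, hsι⟩ := hsub ⟨t₁, ⟨ht₁, le_rfl⟩, rfl⟩
  rcases lt_or_ge s 0 with h | h
  · exact hdisj t₁ ht0 s h hsι.symm
  · exact ht ⟨s, h, hsι⟩

/-- If immersed lines are embedded, then two arcs that meet lie in a common arc. -/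
theorem exists_arc_superset {D : Type*} [TopologicalSpace D] [T2Space D] (hD : IsOneManifold D)
    (hinj : ∀ γ : ℝ → D, Continuous γ → LocallyInjective γ → Function.Injective γ)
    {ι κ : ℝ → D} (hι : IsOpenEmbedding ι) (hκ : IsOpenEmbedding κ)
    (hne : (range ι ∩ range κ).Nonempty) :
    ∃ χ : ℝ → D, IsOpenEmbedding χ ∧ range ι ⊆ range χ ∧ range κ ⊆ range χ := by
  obtain ⟨_, ⟨t₀, rfl⟩, s₀, hs₀⟩ := hne
  have hι₁ : IsOpenEmbedding (fun t => ι (t + t₀)) :=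
    hι.comp (Homeomorph.addRight t₀).isOpenEmbedding
  have hκ₁ : IsOpenEmbedding (fun t => κ (t + s₀)) :=
    hκ.comp (Homeomorph.addRight s₀).isOpenEmbedding
  have hrι : range (fun t => ι (t + t₀)) = range ι :=
    (Homeomorph.addRight t₀).surjective.range_comp ι
  have hrκ : range (fun t => κ (t + s₀)) = range κ :=
    (Homeomorph.addRight s₀).surjective.range_comp κ
  obtain ⟨f, hf, hrf, hf0, hfg, hgf⟩ :=
    exists_compatible_orientation hι₁ hκ₁ (by simpa using hs₀.symm)
  rw [← hrι, ← hrf, ← hrκ]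
  change f 0 = (fun t => κ (t + s₀)) 0 at hf0
  generalize (fun t => κ (t + s₀)) = g at *
  have hfgc := continuous_glueCurves hf.continuous hκ₁.continuous hf0
  have hgfc := continuous_glueCurves hκ₁.continuous hf.continuous hf0.symm
  have hfgi := hinj _ hfgc hfg
  have hgfi := hinj _ hgfc hgf
  have hfge : IsOpenEmbedding (glueCurves f g) :=
    .of_continuous_injective_isOpenMap hfgc hfgi (hfg.isOpenMap hD hfgc)
  have hgfe : IsOpenEmbedding (glueCurves g f) :=
    .of_continuous_injective_isOpenMap hgfc hgfi (hgf.isOpenMap hD hgfc)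
  have hR := image_Ici_subset_or_subset hf.continuous hκ₁ hf0
    (fun t ht s hs => (glueCurves_ne hgfi hs.le ht).symm)
  have hneg : ∀ k : ℝ → D, (fun t => k (-t)) '' Ici 0 = k '' Iic 0 := by
    intro k
    ext x
    constructor
    · rintro ⟨t, ht, rfl⟩
      exact ⟨-t, by simpa using ht, rfl⟩
    · rintro ⟨t, ht, rfl⟩
      exact ⟨-t, by simpa using ht, by simp⟩
  have hL := image_Ici_subset_or_subset (ι := fun t => f (-t)) (κ := fun t => g (-t))
    (hf.continuous.comp continuous_neg) (hκ₁.comp (Homeomorph.neg ℝ).isOpenEmbedding)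
    (by simpa using hf0)
    (fun t ht s hs => glueCurves_ne hfgi (by simpa using ht.le) (by simpa using hs))
  rw [hneg, hneg] at hL
  have hrange : ∀ k : ℝ → D, range k = k '' Iic 0 ∪ k '' Ici 0 := by
    intro k
    rw [← image_union, Iic_union_Ici, image_univ]
  -- On each side one half-arc contains the other; the common arc glues the longer halves.
  rcases hL with hL | hL <;> rcases hR with hR | hR
  · refine ⟨g, hκ₁, ?_, subset_rfl⟩
    rw [hrange f, hrange g]
    exact union_subset_union hL hR
  · refine ⟨_, hgfe, ?_, ?_⟩ <;> rw [range_glueCurves hf0.symm]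
    · rw [hrange f]; exact union_subset_union hL subset_rfl
    · rw [hrange g]; exact union_subset_union subset_rfl hR
  · refine ⟨_, hfge, ?_, ?_⟩ <;> rw [range_glueCurves hf0]
    · rw [hrange f]; exact union_subset_union subset_rfl hR
    · rw [hrange g]; exact union_subset_union hL subset_rfl
  · refine ⟨f, hf, subset_rfl, ?_⟩
    rw [hrange f, hrange g]
    exact union_subset_union hL hR

/-- A locally injective curve that is not injective contains a simple closed loop. -/
theorem LocallyInjective.exists_loop {D : Type*} [TopologicalSpace D] [T2Space D] {γ : ℝ → D}
    (hγ : Continuous γ) (hi : LocallyInjective γ) (hn : ¬ Function.Injective γ) :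
    ∃ u v, u < v ∧ γ u = γ v ∧ InjOn γ (Ico u v) := by
  have : ∃ a b, a < b ∧ γ a = γ b := by
    simp only [Function.Injective, not_forall] at hn
    obtain ⟨a, b, hab, hne⟩ := hn
    rcases lt_or_gt_of_ne hne with h | h
    exacts [⟨a, b, h, hab⟩, ⟨b, a, h, hab.symm⟩]
  obtain ⟨a, b, hab, hγab⟩ := this
  -- A Lebesgue number bounds loop lengths from below, so the parameter pairs of loops in `[a, b]`
  -- form a compact set. A shortest loop is simple.
  choose U hU hUi using hi
  obtain ⟨δ, hδ, hleb⟩ := lebesgue_number_lemma_of_metric (isCompact_Icc (a := a) (b := b))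
    (c := fun t => interior (U t)) (fun _ => isOpen_interior)
    (fun t _ => mem_iUnion.2 ⟨t, mem_interior_iff_mem_nhds.2 (hU t)⟩)
  have hshort : ∀ u ∈ Icc a b, ∀ v, u < v → γ u = γ v → u + δ ≤ v := by
    intro u hu v huv he
    by_contra! hlt
    obtain ⟨t, ht⟩ := hleb u hu
    refine huv.ne (hUi t (interior_subset (ht (Metric.mem_ball_self hδ)))
      (interior_subset (ht ?_)) he)
    rw [Metric.mem_ball, Real.dist_eq, abs_lt]
    constructor <;> linarith
  let K : Set (ℝ × ℝ) := (Icc a b ×ˢ Icc a b) ∩ {q | γ q.1 = γ q.2 ∧ q.1 + δ ≤ q.2}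
  have hK : IsCompact K := by
    refine (isCompact_Icc.prod isCompact_Icc).inter_right (IsClosed.inter ?_ ?_)
    · exact isClosed_eq (hγ.comp continuous_fst) (hγ.comp continuous_snd)
    · exact isClosed_le (continuous_fst.add continuous_const) continuous_snd
  have hKne : K.Nonempty :=
    ⟨(a, b), ⟨⟨le_rfl, hab.le⟩, ⟨hab.le, le_rfl⟩⟩, hγab, hshort a ⟨le_rfl, hab.le⟩ b hab hγab⟩
  obtain ⟨⟨u, v⟩, ⟨⟨hu, hv⟩, huv, hd⟩, hmin⟩ :=
    hK.exists_isMinOn hKne (f := fun q => q.2 - q.1) (by fun_prop)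
  simp only at hu hv huv hd
  have hkey : ∀ x ∈ Ico u v, ∀ y ∈ Ico u v, x < y → γ x ≠ γ y := by
    intro x hx y hy hxy he
    have hx' : x ∈ Icc a b := ⟨hu.1.trans hx.1, hx.2.le.trans hv.2⟩
    have hy' : y ∈ Icc a b := ⟨hu.1.trans hy.1, hy.2.le.trans hv.2⟩
    have := hmin (show (x, y) ∈ K from ⟨⟨hx', hy'⟩, he, hshort x hx' y hxy he⟩)
    simp only [mem_ofPred_eq] at this
    linarith [hx.1, hy.2]
  refine ⟨u, v, by linarith, huv, fun x hx y hy he => ?_⟩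
  by_contra hne
  rcases lt_or_gt_of_ne hne with h | h
  exacts [hkey x hx y hy h he, hkey y hy x hx h he.symm]

/-- A connected one-manifold that contains a simple closed curve is a circle. -/
theorem nonempty_homeomorph_circle_of_loop {D : Type*} [TopologicalSpace D] [T2Space D]
    [PreconnectedSpace D] (hD : IsOneManifold D) {γ : ℝ → D} (hγ : Continuous γ) {u v : ℝ}
    (huv : u < v) (he : γ u = γ v) (hi : InjOn γ (Ico u v)) : Nonempty (D ≃ₜ Circle) := by
  obtain ⟨p, rfl⟩ : ∃ p, v = u + p := ⟨v - u, by ring⟩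
  have hp : 0 < p := by linarith
  have : Fact (0 < p) := ⟨hp⟩
  let G : AddCircle p → D := AddCircle.liftIco p u γ
  have hG : Continuous G := AddCircle.liftIco_continuous he hγ.continuousOn
  have hGi : Function.Injective G := by
    intro x y hxy
    exact (AddCircle.equivIco p u).injective (Subtype.ext
      (hi (AddCircle.equivIco p u x).2 (AddCircle.equivIco p u y).2 hxy))
  have hcoe : Continuous (fun t : ℝ => (t : AddCircle p)) := AddCircle.continuous_mk' p
  have hloc : LocallyInjective (fun t : ℝ => G (t : AddCircle p)) := by
    intro t
    refine ⟨Ico (t - p / 2) (t - p / 2 + p), Ico_mem_nhds (by linarith) (by linarith), ?_⟩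
    intro x hx y hy hxy
    exact (AddCircle.coe_eq_coe_iff_of_mem_Ico hx hy).1 (hGi hxy)
  -- The embedded circle is open by invariance of domain and closed by compactness, so it fills the
  -- connected space.
  have hopen : IsOpen (range G) := by
    have h1 : IsOpen (range fun t : ℝ => G (t : AddCircle p)) :=
      (hloc.isOpenMap hD (hG.comp hcoe)).isOpen_range
    have h2 : range (fun t : ℝ => G (t : AddCircle p)) = range G :=
      (QuotientAddGroup.mk_surjective (s := AddSubgroup.zmultiples p)).range_comp G
    rwa [h2] at h1
  have hclosed : IsClosed (range G) := (isCompact_range hG).isClosed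
  have huniv : range G = univ := IsClopen.eq_univ ⟨hclosed, hopen⟩ (range_nonempty G)
  let e : AddCircle p ≃ D := Equiv.ofBijective G ⟨hGi, range_eq_univ.1 huniv⟩
  have hec : Continuous e := hG
  exact ⟨(hec.homeoOfEquivCompactToT2).symm.trans (AddCircle.homeomorphCircle hp.ne')⟩

/-- A compact connected one-manifold is a circle. -/
theorem nonempty_homeomorph_circle {D : Type*} [TopologicalSpace D] [T2Space D] [CompactSpace D]
    [ConnectedSpace D] (hD : IsOneManifold D) : Nonempty (D ≃ₜ Circle) := by
  by_contra hcon
  have hinj : ∀ γ : ℝ → D, Continuous γ → LocallyInjective γ → Function.Injective γ := by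
    intro γ hγ hloc
    by_contra hn
    obtain ⟨u, v, huv, he, hi⟩ := hloc.exists_loop hγ hn
    exact hcon (nonempty_homeomorph_circle_of_loop hD hγ huv he hi)
  choose ι hι hι0 using hD
  obtain ⟨t, ht⟩ := isCompact_univ.elim_finite_subcover (fun p => range (ι p))
    (fun p => (hι p).isOpen_range) (fun p _ => mem_iUnion.2 ⟨p, 0, hι0 p⟩)
  -- A maximal family of covering arcs lying in one arc `χ` absorbs every covering arc that meets
  -- `χ`, so `χ` is clopen. The space would then be a line, which is not compact.
  let A : Set (Set t) := {s | ∃ χ : ℝ → D, IsOpenEmbedding χ ∧ ∀ p ∈ s, range (ι p) ⊆ range χ}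
  have hA : A.Nonempty :=
    ⟨∅, ι (Classical.arbitrary D), hι _, fun p hp => (notMem_empty p hp).elim⟩
  obtain ⟨m, ⟨χ, hχ, hmχ⟩, hmax⟩ := (toFinite A).exists_maximal hA
  have habs : ∀ p : t, (range χ ∩ range (ι p)).Nonempty → range (ι p) ⊆ range χ := by
    intro p hp
    obtain ⟨χ', hχ', h1, h2⟩ := exists_arc_superset (fun p => ⟨ι p, hι p, hι0 p⟩) hinj hχ (hι p) hp
    refine hmχ p (hmax (y := insert p m) ⟨χ', hχ', ?_⟩ (subset_insert p m) (mem_insert p m))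
    rintro q (rfl | hq)
    exacts [h2, (hmχ q hq).trans h1]
  have hcl : IsClosed (range χ) := by
    rw [← isOpen_compl_iff, isOpen_iff_mem_nhds]
    intro x hx
    obtain ⟨p, hp⟩ := mem_iUnion.1 (ht (mem_univ x))
    obtain ⟨hpt, hxp⟩ := mem_iUnion.1 hp
    refine mem_of_superset ((hι p).isOpen_range.mem_nhds hxp) fun y hy hyχ => ?_
    exact hx (habs ⟨p, hpt⟩ ⟨y, hyχ, hy⟩ hxp)
  have huniv : range χ = univ := IsClopen.eq_univ ⟨hcl, hχ.isOpen_range⟩ (range_nonempty χ)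
  refine noncompact_univ ℝ ?_
  rw [hχ.isInducing.isCompact_iff, image_univ, huniv]
  exact isCompact_univ

/-! ### Invariance of `O_X` and `S_X`, small arcs, and the compact-open group topology -/

section Spaces

variable {X : Type*} [TopologicalSpace X]

theorem isOpen_oneManifoldPart : IsOpen (oneManifoldPart X) := by
  rw [isOpen_iff_mem_nhds]
  rintro x ⟨U, hU, e⟩
  exact mem_of_superset (interior_mem_nhds.2 hU) fun y hy => ⟨U, mem_interior_iff_mem_nhds.1 hy, e⟩

theorem isOpen_circlePart : IsOpen (circlePart X) := by
  rw [isOpen_iff_mem_nhds]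
  rintro x ⟨U, hU, hUc, e⟩
  exact mem_of_superset hU fun y hy => ⟨U, hUc.isOpen.mem_nhds hy, hUc, e⟩

theorem isClosed_singularPart : IsClosed (singularPart X) :=
  isOpen_oneManifoldPart.isClosed_compl

theorem apply_mem_oneManifoldPart (h : X ≃ₜ X) {x : X} (hx : x ∈ oneManifoldPart X) :
    h x ∈ oneManifoldPart X := by
  obtain ⟨U, hU, ⟨e⟩⟩ := hx
  exact ⟨h '' U, h.isOpenMap.image_mem_nhds hU, ⟨(h.image U).symm.trans e⟩⟩

theorem apply_mem_circlePart (h : X ≃ₜ X) {x : X} (hx : x ∈ circlePart X) :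
    h x ∈ circlePart X := by
  obtain ⟨U, hU, hUc, ⟨e⟩⟩ := hx
  refine ⟨h '' U, h.isOpenMap.image_mem_nhds hU, ⟨h.isClosedMap _ hUc.1, h.isOpenMap _ hUc.2⟩,
    ⟨(h.image U).symm.trans e⟩⟩

/-- Every point of the one-manifold part is the center of arbitrarily small open arcs. -/
theorem exists_arc {p : X} (hp : p ∈ oneManifoldPart X) {W : Set X} (hW : W ∈ 𝓝 p) :
    ∃ ι : ℝ → X, IsOpenEmbedding ι ∧ ι 0 = p ∧ range ι ⊆ W := by
  obtain ⟨U, hU, ⟨e⟩⟩ := hp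
  have hpU : p ∈ U := mem_of_mem_nhds hU
  let j : Ioo (0 : ℝ) 1 → X := fun s => (e.symm s : X)
  have hj : IsEmbedding j := IsEmbedding.subtypeVal.comp e.symm.isEmbedding
  let G : Set X := interior (U ∩ W)
  have hpG : p ∈ G := mem_interior_iff_mem_nhds.2 (inter_mem hU hW)
  have hA : IsOpen (Subtype.val '' (j ⁻¹' G) : Set ℝ) :=
    isOpen_Ioo.isOpenMap_subtype_val _ (isOpen_interior.preimage hj.continuous)
  have hpA : (e ⟨p, hpU⟩ : ℝ) ∈ (Subtype.val '' (j ⁻¹' G) : Set ℝ) :=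
    ⟨e ⟨p, hpU⟩, by simpa [j] using hpG, rfl⟩
  obtain ⟨r, hr, hball⟩ := Metric.isOpen_iff.1 hA _ hpA
  let φ := OpenPartialHomeomorph.univBall (e ⟨p, hpU⟩ : ℝ) r
  have hφ : IsOpenEmbedding φ := φ.isOpenEmbedding (OpenPartialHomeomorph.univBall_source _ _)
  have hφA : ∀ s, φ s ∈ (Subtype.val '' (j ⁻¹' G) : Set ℝ) := by
    intro s
    have : φ s ∈ φ.target := φ.map_source (by simp [φ])
    rw [OpenPartialHomeomorph.univBall_target _ hr] at this
    exact hball this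
  have hφI : ∀ s, φ s ∈ Ioo (0 : ℝ) 1 := by
    intro s
    obtain ⟨q, -, hq⟩ := hφA s
    rw [← hq]
    exact q.2
  let ψ : ℝ → Ioo (0 : ℝ) 1 := fun s => ⟨φ s, hφI s⟩
  have hψ : IsOpenEmbedding ψ :=
    IsOpenEmbedding.of_comp ψ isOpen_Ioo.isOpenEmbedding_subtypeVal hφ
  have hjG : ∀ s, j (ψ s) ∈ G := by
    intro s
    obtain ⟨q, hqG, hq⟩ := hφA s
    have : q = ψ s := Subtype.ext hq
    rwa [← this]
  refine ⟨j ∘ ψ, ⟨hj.comp hψ.isEmbedding, ?_⟩, ?_, ?_⟩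
  -- The arc is a priori open only in `U`, which need not be open in `X`; lying in the open set `G ⊆
  -- U` makes it open in `X`.
  · obtain ⟨O, hO, hOeq⟩ := isOpen_induced_iff.1 (e.symm.isOpenMap _ hψ.isOpen_range)
    have : range (j ∘ ψ) = O ∩ G := by
      ext x
      constructor
      · rintro ⟨s, rfl⟩
        refine ⟨?_, hjG s⟩
        have : e.symm (ψ s) ∈ Subtype.val ⁻¹' O := hOeq ▸ ⟨ψ s, ⟨s, rfl⟩, rfl⟩
        exact this
      · rintro ⟨hxO, hxG⟩
        have hxU : x ∈ U := (interior_subset hxG).1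
        have : (⟨x, hxU⟩ : U) ∈ e.symm '' range ψ := hOeq ▸ hxO
        obtain ⟨_, ⟨s, rfl⟩, hs⟩ := this
        exact ⟨s, congrArg Subtype.val hs⟩
    rw [this]
    exact hO.inter isOpen_interior
  · have h0 : ψ 0 = e ⟨p, hpU⟩ := Subtype.ext (OpenPartialHomeomorph.univBall_apply_zero _ _)
    simp [j, h0]
  · rintro _ ⟨s, rfl⟩
    exact (interior_subset (hjG s)).2

theorem isHausdorffGroupTopology_compactOpenTopology [CompactSpace X] [T2Space X] :
    IsHausdorffGroupTopology (compactOpenTopology X) := by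
  let _ := compactOpenTopology X
  have hc : Continuous (fun h : X ≃ₜ X => (h : C(X, X))) := continuous_induced_dom
  refine ⟨?_, ?_⟩
  · refine { continuous_mul := ?_, continuous_inv := ?_ }
    · refine continuous_induced_rng.2 ?_
      exact (hc.comp continuous_fst).compCM (hc.comp continuous_snd)
    · refine continuous_induced_rng.2 (ContinuousMap.continuous_compactOpen.2 ?_)
      intro K hK U hU
      -- `h⁻¹` maps `K` into `U` exactly when `h` maps `Uᶜ` into `Kᶜ`, and `Uᶜ` is compact.
      have h1 : IsOpen {h : X ≃ₜ X | MapsTo (h : C(X, X)) Uᶜ Kᶜ} :=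
        (ContinuousMap.isOpen_setOfPred_mapsTo hU.isClosed_compl.isCompact
          hK.isClosed.isOpen_compl).preimage hc
      convert h1 using 1
      ext h
      constructor
      · intro hm x hx hxK
        exact hx (by simpa using hm hxK)
      · intro hm x hx
        by_contra hn
        exact hm hn (by simpa using hx)
  · refine T2Space.of_injective_continuous (f := fun h : X ≃ₜ X => (h : C(X, X))) ?_ hc
    intro f g hfg
    ext x
    exact DFunLike.congr_fun hfg x

end Spaces

/-! ### Homeomorphisms supported in an arc -/

section Bump

theorem strictMono_bump (c : ℝ) : StrictMono fun x : ℝ => x + max 0 (1 - |x - c|) / 2 := by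
  intro x y hxy
  rcases max_cases 0 (1 - |x - c|) with h1 | h1 <;> rcases max_cases 0 (1 - |y - c|) with h2 | h2 <;>
    rcases abs_cases (x - c) with h3 | h3 <;> rcases abs_cases (y - c) with h4 | h4 <;>
    simp only [h1.1, h2.1] <;> linarith

/-- A homeomorphism of the line that moves exactly the points at distance less than one from `c`. -/
noncomputable def bumpHomeomorph (c : ℝ) : ℝ ≃ₜ ℝ :=
  ((strictMono_bump c).orderIsoOfSurjective _ (by
    refine Continuous.surjective (by fun_prop) ?_ ?_
    · exact tendsto_atTop_mono (fun x => by
        have := le_max_left 0 (1 - |x - c|); simp only [id]; linarith) tendsto_id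
    · refine tendsto_atBot_mono (fun x => ?_) (tendsto_atBot_add_const_right atBot (1 : ℝ) tendsto_id)
      have : max 0 (1 - |x - c|) ≤ 1 := max_le zero_le_one (by linarith [abs_nonneg (x - c)])
      simp only [id]
      linarith)).toHomeomorph

theorem bumpHomeomorph_apply (c x : ℝ) : bumpHomeomorph c x = x + max 0 (1 - |x - c|) / 2 := rfl

theorem bumpHomeomorph_apply_of_le {c x : ℝ} (h : 1 ≤ |x - c|) : bumpHomeomorph c x = x := by
  rw [bumpHomeomorph_apply, max_eq_left (by linarith)]
  simp

variable {X : Type*} [TopologicalSpace X]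

/-- The extension is the identity off `ι '' Icc (-R) R`, which is closed because it is compact in a
Hausdorff space. -/
theorem continuous_extend_arc [T2Space X] {ι : ℝ → X} (hι : IsOpenEmbedding ι) {F : ℝ → ℝ}
    (hF : Continuous F) {R : ℝ} (hR : ∀ t, R < |t| → F t = t) :
    Continuous (Function.extend ι (ι ∘ F) id) := by
  rw [continuous_iff_continuousAt]
  intro x
  by_cases hx : x ∈ range ι
  · obtain ⟨t, rfl⟩ := hx
    rw [← hι.continuousAt_iff, show Function.extend ι (ι ∘ F) id ∘ ι = ι ∘ F from
      funext fun s => hι.injective.extend_apply _ _ s]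
    exact (hι.continuous.comp hF).continuousAt
  · have hK : IsClosed (ι '' Icc (-R) R) := (isCompact_Icc.image hι.continuous).isClosed
    have hxK : x ∈ (ι '' Icc (-R) R)ᶜ := fun h => hx (image_subset_range _ _ h)
    refine continuousAt_id.congr (Filter.eventually_of_mem (hK.isOpen_compl.mem_nhds hxK) ?_)
    intro y hy
    by_cases hyr : y ∈ range ι
    · obtain ⟨t, rfl⟩ := hyr
      have ht : R < |t| := by
        by_contra! hle
        exact hy ⟨t, abs_le.1 hle, rfl⟩
      simp [hι.injective.extend_apply, hR t ht]
    · rw [Function.extend_apply' _ _ _ (by simpa using hyr)]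

/-- A compactly supported homeomorphism of an open arc extends by the identity. -/
theorem exists_homeomorph_extend_arc [T2Space X] {ι : ℝ → X} (hι : IsOpenEmbedding ι) (F : ℝ ≃ₜ ℝ)
    {R : ℝ} (hR : ∀ t, R < |t| → F t = t) :
    ∃ f : X ≃ₜ X, (∀ t, f (ι t) = ι (F t)) ∧ ∀ x ∉ range ι, f x = x := by
  have hR' : ∀ t, R < |t| → F.symm t = t := fun t ht => by
    rw [Homeomorph.symm_apply_eq, hR t ht]
  have happ : ∀ (H : ℝ → ℝ) (t : ℝ), Function.extend ι (ι ∘ H) id (ι t) = ι (H t) :=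
    fun H t => hι.injective.extend_apply _ _ t
  have happ' : ∀ (H : ℝ → ℝ), ∀ x ∉ range ι, Function.extend ι (ι ∘ H) id x = x :=
    fun H x hx => Function.extend_apply' _ _ _ (by simpa using hx)
  have hinv : ∀ H K : ℝ → ℝ, Function.LeftInverse H K →
      Function.LeftInverse (Function.extend ι (ι ∘ H) id) (Function.extend ι (ι ∘ K) id) := by
    intro H K hHK x
    by_cases hx : x ∈ range ι
    · obtain ⟨t, rfl⟩ := hx
      rw [happ, happ, hHK t]
    · rw [happ' K x hx, happ' H x hx]
  exact ⟨{ toFun := Function.extend ι (ι ∘ F) id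
           invFun := Function.extend ι (ι ∘ F.symm) id
           left_inv := hinv _ _ F.symm_apply_apply
           right_inv := hinv _ _ F.apply_symm_apply
           continuous_toFun := continuous_extend_arc hι F.continuous hR
           continuous_invFun := continuous_extend_arc hι F.symm.continuous hR' },
    happ F, happ' F⟩

/-- There are non-commuting homeomorphisms supported in any given open arc. -/
theorem exists_not_commute_supported [T2Space X] {ι : ℝ → X} (hι : IsOpenEmbedding ι) :
    ∃ f g : X ≃ₜ X, f * g ≠ g * f ∧ (∀ x ∉ range ι, f x = x) ∧ ∀ x ∉ range ι, g x = x := by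
  obtain ⟨f, hf, hf'⟩ := exists_homeomorph_extend_arc hι (bumpHomeomorph 0) (R := 2)
    (fun t ht => bumpHomeomorph_apply_of_le (by rw [sub_zero]; linarith))
  obtain ⟨g, hg, hg'⟩ := exists_homeomorph_extend_arc hι (bumpHomeomorph 1) (R := 2)
    (fun t ht => bumpHomeomorph_apply_of_le (by
      have := abs_sub_abs_le_abs_sub t 1
      rw [abs_one] at this
      linarith))
  refine ⟨f, g, fun h => ?_, hf', hg'⟩
  -- At parameter `0` the two orders of composition give `1/2` and `3/4`.
  have h0 : f (g (ι 0)) = g (f (ι 0)) := DFunLike.congr_fun h (ι 0)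
  rw [hg, hf, hf, hg] at h0
  have := hι.injective h0
  norm_num [bumpHomeomorph_apply, abs_of_pos, abs_of_neg] at this

end Bump

/-! ### Shrunk balls are neighborhoods of the identity in every Hausdorff group topology -/

section MinimumTopology

variable {X : Type*} [TopologicalSpace X] [T2Space X]

/-- In any Hausdorff group topology, the homeomorphisms near the identity do not move an open arc
off itself. -/
theorem arc_meets_image_mem_nhds [TopologicalSpace (X ≃ₜ X)] [IsTopologicalGroup (X ≃ₜ X)]
    [T2Space (X ≃ₜ X)] {ι : ℝ → X} (hι : IsOpenEmbedding ι) :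
    {h : X ≃ₜ X | ∃ x ∈ range ι, h x ∈ range ι} ∈ 𝓝 1 := by
  obtain ⟨f, g, hfg, hf, hg⟩ := exists_not_commute_supported hι
  have hopen : IsOpen {h : X ≃ₜ X | h * f * h⁻¹ * g ≠ g * (h * f * h⁻¹)} :=
    isOpen_ne_fun (by fun_prop) (by fun_prop)
  refine mem_of_superset (hopen.mem_nhds (by simpa using hfg)) ?_
  intro h hh
  by_contra hcon
  simp only [mem_ofPred_eq, not_exists, not_and] at hcon
  refine hh ?_
  -- If `h` moves the arc off itself, the conjugate of `f` is supported off the arc and hence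
  -- commutes with `g`.
  have hfix : ∀ y ∈ range ι, (h * f * h⁻¹) y = y := by
    intro y hy
    have : h.symm y ∉ range ι := fun hm => hcon _ hm (by simpa using hy)
    simp [hf _ this]
  have hgmem : ∀ y ∈ range ι, g y ∈ range ι := by
    intro y hy
    by_contra hn
    exact hn (by rwa [g.injective (hg _ hn)])
  ext x
  by_cases hx : x ∈ range ι
  · rw [Homeomorph.mul_apply, hfix _ (hgmem x hx), Homeomorph.mul_apply, hfix x hx]
  · rw [Homeomorph.mul_apply, hg x hx, Homeomorph.mul_apply]
    by_cases hm : h.symm x ∈ range ι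
    · by_cases hfm : f (h.symm x) ∈ range ι
      · have := hcon _ hfm
        simp [hg _ this]
      · have := f.injective (hf _ hfm)
        rw [this] at hfm
        exact (hfm hm).elim
    · simp [hf _ hm, hg x hx]

end MinimumTopology

section Metric

variable {X : Type*} [MetricSpace X]

/-- In any Hausdorff group topology, homeomorphisms near the identity are uniformly close to the
identity near a given point of the one-manifold part. -/
theorem exists_nhds_forall_dist_lt_mem_nhds [TopologicalSpace (X ≃ₜ X)]
    [IsTopologicalGroup (X ≃ₜ X)] [T2Space (X ≃ₜ X)] {p : X} (hp : p ∈ oneManifoldPart X)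
    {ε : ℝ} (hε : 0 < ε) :
    ∃ N ∈ 𝓝 p, {h : X ≃ₜ X | ∀ x ∈ N, dist (h x) x < ε} ∈ 𝓝 1 := by
  obtain ⟨ι, hι, hι0, hsub⟩ := exists_arc hp (Metric.ball_mem_nhds p (half_pos hε))
  have key : ∀ a b : ℝ, a < b →
      {h : X ≃ₜ X | ∃ s ∈ Ioo a b, ∃ t ∈ Ioo a b, h (ι s) = ι t} ∈ 𝓝 1 := by
    intro a b hab
    let φ := OpenPartialHomeomorph.univBall ((a + b) / 2) ((b - a) / 2)
    have hφ : IsOpenEmbedding φ := φ.isOpenEmbedding (OpenPartialHomeomorph.univBall_source _ _)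
    have hφm : ∀ s, φ s ∈ Ioo a b := by
      intro s
      have : φ s ∈ φ.target := φ.map_source (by simp [φ])
      rw [OpenPartialHomeomorph.univBall_target _ (by linarith), Real.ball_eq_Ioo] at this
      constructor <;> linarith [this.1, this.2]
    refine mem_of_superset (arc_meets_image_mem_nhds (hι.comp hφ)) ?_
    rintro h ⟨_, ⟨s, rfl⟩, t, ht⟩
    exact ⟨φ s, hφm s, φ t, hφm t, ht.symm⟩
  refine ⟨ι '' Ioo (-1) 1, hι0 ▸ hι.isOpenMap.image_mem_nhds (Ioo_mem_nhds (by norm_num)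
    (by norm_num)), ?_⟩
  filter_upwards [key (-4) (-3) (by norm_num), key (-2) (-1) (by norm_num),
    key 1 2 (by norm_num), key 3 4 (by norm_num)] with h h1 h2 h3 h4
  obtain ⟨s₁, hs₁, t₁, ht₁, h1⟩ := h1
  obtain ⟨s₂, hs₂, t₂, ht₂, h2⟩ := h2
  obtain ⟨s₃, hs₃, t₃, ht₃, h3⟩ := h3
  obtain ⟨s₄, hs₄, t₄, ht₄, h4⟩ := h4
  -- By injectivity the image misses `ι t₁` and `ι t₄`, already taken at `s₁` and `s₄`, while it
  -- contains `ι t₃` between them.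
  have htrap : h '' (ι '' Icc s₂ s₃) ⊆ ι '' Ioo t₁ t₄ := by
    refine subset_image_Ioo_of_isPreconnected hι
      ((isPreconnected_Icc.image _ hι.continuous.continuousOn).image _ h.continuous.continuousOn)
      ⟨ι t₃, ⟨ι s₃, ⟨s₃, ⟨by linarith [hs₂.2, hs₃.1], le_rfl⟩, rfl⟩, h3⟩,
        t₃, ⟨by linarith [ht₁.2, ht₃.1], by linarith [ht₃.2, ht₄.1]⟩, rfl⟩ ?_ ?_
    · rintro ⟨_, ⟨s, hs, rfl⟩, he⟩
      have := hι.injective (h.injective (he.trans h1.symm))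
      linarith [hs.1, hs₁.2, hs₂.1]
    · rintro ⟨_, ⟨s, hs, rfl⟩, he⟩
      have := hι.injective (h.injective (he.trans h4.symm))
      linarith [hs.2, hs₄.1, hs₃.2]
  rintro _ ⟨s, hs, rfl⟩
  obtain ⟨t, -, ht⟩ := htrap ⟨ι s, ⟨s, ⟨by linarith [hs.1, hs₂.2], by linarith [hs.2, hs₃.1]⟩, rfl⟩,
    rfl⟩
  rw [← ht]
  have d1 : dist (ι t) p < ε / 2 := hsub ⟨t, rfl⟩
  have d2 : dist (ι s) p < ε / 2 := hsub ⟨s, rfl⟩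
  linarith [dist_triangle_right (ι t) (ι s) p]

theorem shrunkBall_mem_nhds [CompactSpace X] [TopologicalSpace (X ≃ₜ X)]
    [IsTopologicalGroup (X ≃ₜ X)] [T2Space (X ≃ₜ X)] {ε : ℝ} (hε : 0 < ε) :
    shrunkBall (singularPart X) ε ∈ 𝓝 (1 : X ≃ₜ X) := by
  have hK : IsCompact (Metric.thickening ε (singularPart X))ᶜ :=
    Metric.isOpen_thickening.isClosed_compl.isCompact
  have h1 : {h : X ≃ₜ X | ∀ x ∈ (Metric.thickening ε (singularPart X))ᶜ, dist (h x) x < ε} ∈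
      𝓝 (1 : X ≃ₜ X) := by
    refine hK.induction_on (p := fun K => {h : X ≃ₜ X | ∀ x ∈ K, dist (h x) x < ε} ∈ 𝓝 1)
      (by simp) (fun s t hst ht => mem_of_superset ht fun h hh x hx => hh x (hst hx)) ?_ ?_
    · intro s t hs ht
      filter_upwards [hs, ht] with h h1 h2 x hx
      exact hx.elim (h1 x) (h2 x)
    · intro x hx
      have hxO : x ∈ oneManifoldPart X := by
        by_contra hn
        exact hx (Metric.self_subset_thickening hε _ hn)
      obtain ⟨N, hN, hmem⟩ := exists_nhds_forall_dist_lt_mem_nhds hxO hε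
      exact ⟨N, mem_nhdsWithin_of_mem_nhds hN, hmem⟩
  have h2 : {h : X ≃ₜ X | ∀ x ∈ (Metric.thickening ε (singularPart X))ᶜ, dist (h⁻¹ x) x < ε} ∈
      𝓝 (1 : X ≃ₜ X) :=
    (continuous_inv.tendsto' (1 : X ≃ₜ X) 1 inv_one) h1
  filter_upwards [h1, h2] with h ha hb x hx
  exact ⟨ha x hx, hb x hx⟩

end Metric

/-! ### Finite separators and boundary bumping -/

section Separation

theorem disjoint_frontier_of_subset {X : Type*} [TopologicalSpace X] {V P Q C : Set X}
    (hV : IsOpen V) (hPV : P ⊆ V) (hVQ : Disjoint (closure V) Q) (hC : C ⊆ P ∪ Q) : Disjoint (frontier V) C := by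
  rw [disjoint_left]
  intro x hx hxC
  rcases hC hxC with h | h
  · rw [hV.frontier_eq] at hx
    exact hx.2 (hPV h)
  · exact disjoint_left.1 hVQ (frontier_subset_closure hx) h

variable {X : Type*} [TopologicalSpace X] [CompactSpace X] [T2Space X]

/-- Disjoint closed sets that cover the singular part are separated by a finite set. -/
theorem exists_isOpen_finite_frontier {P Q : Set X} (hP : IsClosed P) (hQ : IsClosed Q)
    (hPQ : Disjoint P Q) (hC : singularPart X ⊆ P ∪ Q) :
    ∃ V, IsOpen V ∧ P ⊆ V ∧ Disjoint (closure V) Q ∧ (frontier V).Finite := by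
  obtain ⟨V₀, hV₀, hPV₀, hV₀Q⟩ :=
    normal_exists_closure_subset hP hQ.isOpen_compl hPQ.subset_compl_right
  have hM : IsCompact (frontier V₀) := isClosed_frontier.isCompact
  have hMC := disjoint_frontier_of_subset hV₀ hPV₀ (subset_compl_iff_disjoint_right.1 hV₀Q) hC
  -- The frontier of `V₀` is a compact subset of `O_X`, so finitely many short open arcs, each with
  -- at most two frontier points, cover it. Adding them to `V₀` leaves only their frontier points.
  obtain ⟨W, hW, hMW, hWQ, hWf⟩ : ∃ W : Set X, IsOpen W ∧ frontier V₀ ⊆ W ∧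
      Disjoint (closure W) Q ∧ (frontier W).Finite := by
    refine hM.induction_on (p := fun K => ∃ W : Set X, IsOpen W ∧ K ⊆ W ∧
      Disjoint (closure W) Q ∧ (frontier W).Finite)
      ⟨∅, isOpen_empty, subset_rfl, by simp, by simp⟩ ?_ ?_ ?_
    · rintro s t hst ⟨W, h1, h2, h3⟩
      exact ⟨W, h1, hst.trans h2, h3⟩
    · rintro s t ⟨W, h1, h2, h3, h4⟩ ⟨W', h1', h2', h3', h4'⟩
      refine ⟨W ∪ W', h1.union h1', union_subset_union h2 h2', ?_, ?_⟩
      · rw [closure_union]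
        exact h3.union_left h3'
      · refine (h4.union h4').subset ((frontier_union_subset W W').trans ?_)
        exact union_subset_union inter_subset_left inter_subset_right
    · intro x hx
      have hxO : x ∈ oneManifoldPart X := by
        by_contra hn
        exact disjoint_left.1 hMC hx hn
      have hxQ : x ∈ Qᶜ := hV₀Q (frontier_subset_closure hx)
      obtain ⟨ι, hι, hι0, hsub⟩ := exists_arc hxO (hQ.isOpen_compl.mem_nhds hxQ)
      have hcl : closure (ι '' Ioo (-1) 1) ⊆ ι '' Icc (-1) 1 :=
        closure_minimal (image_mono Ioo_subset_Icc_self)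
          (isCompact_Icc.image hι.continuous).isClosed
      have hop : IsOpen (ι '' Ioo (-1) 1) := hι.isOpenMap _ isOpen_Ioo
      refine ⟨ι '' Ioo (-1) 1, mem_nhdsWithin_of_mem_nhds (hop.mem_nhds
        ⟨0, by norm_num, hι0⟩), ι '' Ioo (-1) 1, hop, subset_rfl, ?_, ?_⟩
      · exact subset_compl_iff_disjoint_right.1 (hcl.trans ((image_subset_range _ _).trans hsub))
      · refine (toFinite {ι (-1), ι 1}).subset ?_
        rw [hop.frontier_eq]
        rintro _ ⟨hy, hn⟩
        obtain ⟨t, ht, rfl⟩ := hcl hy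
        rcases ht.1.eq_or_lt with rfl | h1
        · simp
        rcases ht.2.eq_or_lt with rfl | h2
        · simp
        exact (hn ⟨t, ⟨h1, h2⟩, rfl⟩).elim
  refine ⟨V₀ ∪ W, hV₀.union hW, hPV₀.trans subset_union_left, ?_, hWf.subset ?_⟩
  · rw [closure_union]
    exact (subset_compl_iff_disjoint_right.1 hV₀Q).union_left hWQ
  · rw [(hV₀.union hW).frontier_eq, hW.frontier_eq, closure_union]
    rintro x ⟨h | h, hn⟩
    · exact (hn (Or.inr (hMW (hV₀.frontier_eq ▸ ⟨h, fun hx => hn (Or.inl hx)⟩)))).elim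
    · exact ⟨h, fun hx => hn (Or.inr hx)⟩

/-- Boundary bumping: a point of an open set `V` either is joined to the frontier of `V` by a
connected subset of the closure, or has its component in `V`. -/
theorem exists_preconnected_meets_frontier_or_component_subset {V : Set X} (hV : IsOpen V) {x : X}
    (hx : x ∈ V) :
    (∃ D, IsPreconnected D ∧ x ∈ D ∧ D ⊆ closure V ∧ (D ∩ frontier V).Nonempty) ∨
      connectedComponent x ⊆ V := by
  have : CompactSpace (closure V) := isCompact_iff_compactSpace.1 isClosed_closure.isCompact
  let a : closure V := ⟨x, subset_closure hx⟩
  by_cases hne : (connectedComponent a ∩ Subtype.val ⁻¹' frontier V).Nonempty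
  · obtain ⟨z, hz, hzf⟩ := hne
    refine Or.inl ⟨Subtype.val '' connectedComponent a,
      isPreconnected_connectedComponent.image _ continuous_subtype_val.continuousOn,
      ⟨a, mem_connectedComponent, rfl⟩, ?_, ⟨z, ⟨z, hz, rfl⟩, hzf⟩⟩
    rintro _ ⟨w, -, rfl⟩
    exact w.2
  · right
    rw [not_nonempty_iff_eq_empty, inter_comm, connectedComponent_eq_iInter_isClopen] at hne
    have hcl : IsClosed (Subtype.val ⁻¹' frontier V : Set (closure V)) :=
      isClosed_frontier.preimage continuous_subtype_val
    have : Nonempty { s : Set (closure V) // IsClopen s ∧ a ∈ s } :=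
      ⟨⟨univ, isClopen_univ, mem_univ a⟩⟩
    -- In a compact Hausdorff space components are intersections of clopen sets, so by compactness a
    -- single clopen subset of `closure V` already misses the frontier. It lies in `V`, hence is
    -- clopen in `X`.
    obtain ⟨⟨E, hE, haE⟩, hEf⟩ := hcl.isCompact.elim_directed_family_closed
      (fun s : { s : Set (closure V) // IsClopen s ∧ a ∈ s } => s.1)
      (fun s => s.2.1.1) hne (by
        intro s t
        exact ⟨⟨s.1 ∩ t.1, s.2.1.inter t.2.1, s.2.2, t.2.2⟩, inter_subset_left,
          inter_subset_right⟩)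
    have hEV : Subtype.val '' E ⊆ V := by
      rintro _ ⟨z, hz, rfl⟩
      by_contra hn
      have : z ∈ Subtype.val ⁻¹' frontier V ∩ E := ⟨hV.frontier_eq ▸ ⟨z.2, hn⟩, hz⟩
      exact (hEf ▸ this : z ∈ (∅ : Set _))
    have hEclopen : IsClopen (Subtype.val '' E : Set X) := by
      refine ⟨isClosed_closure.isClosedMap_subtype_val _ hE.1, ?_⟩
      obtain ⟨O, hO, hOE⟩ := isOpen_induced_iff.1 hE.2
      have : Subtype.val '' E = O ∩ V := by
        ext y
        constructor
        · rintro ⟨z, hz, rfl⟩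
          exact ⟨by rw [← hOE] at hz; exact hz, hEV ⟨z, hz, rfl⟩⟩
        · rintro ⟨hyO, hyV⟩
          exact ⟨⟨y, subset_closure hyV⟩, by rw [← hOE]; exact hyO, rfl⟩
      rw [this]
      exact hO.inter hV
    exact (hEclopen.connectedComponent_subset ⟨a, haE, rfl⟩).trans hEV

/-- A component that consists of one-manifold points is an isolated circle. -/
theorem mem_circlePart_of_component_subset {p : X}
    (hp : connectedComponent p ⊆ oneManifoldPart X) : p ∈ circlePart X := by
  have harc : ∀ (ι : ℝ → X), Continuous ι → ι 0 ∈ connectedComponent p →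
      range ι ⊆ connectedComponent p := by
    intro ι hι h0
    rw [connectedComponent_eq h0]
    exact (isPreconnected_range hι).subset_connectedComponent ⟨0, rfl⟩
  have hopen : IsOpen (connectedComponent p) := by
    rw [isOpen_iff_mem_nhds]
    intro q hq
    obtain ⟨ι, hι, rfl, -⟩ := exists_arc (hp hq) univ_mem
    exact mem_of_superset (hι.isOpen_range.mem_nhds ⟨0, rfl⟩) (harc ι hι.continuous hq)
  have : CompactSpace (connectedComponent p) :=
    isCompact_iff_compactSpace.1 isClosed_connectedComponent.isCompact
  have : ConnectedSpace (connectedComponent p) :=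
    isConnected_iff_connectedSpace.1 isConnected_connectedComponent
  refine ⟨connectedComponent p, hopen.mem_nhds mem_connectedComponent,
    ⟨isClosed_connectedComponent, hopen⟩, nonempty_homeomorph_circle ?_⟩
  rintro ⟨q, hq⟩
  obtain ⟨ι, hι, rfl, -⟩ := exists_arc (hp hq) univ_mem
  exact ⟨fun t => ⟨ι t, harc ι hι.continuous hq ⟨t, rfl⟩⟩,
    IsOpenEmbedding.of_comp _ hopen.isOpenEmbedding_subtypeVal hι, rfl⟩

end Separation

/-! ### Trapping connected sets under homeomorphisms close to the identity off `C` -/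

section Convergence

variable {α X : Type*} [TopologicalSpace X]

/-- The homeomorphisms `h n` and their inverses converge to the identity locally uniformly off the
singular part. -/
def TendstoIdOffSingular (l : Filter α) (h : α → X ≃ₜ X) : Prop :=
  ∀ w ∉ singularPart X, Tendsto (fun q : α × X => h q.1 q.2) (l ×ˢ 𝓝 w) (𝓝 w) ∧
    Tendsto (fun q : α × X => (h q.1).symm q.2) (l ×ˢ 𝓝 w) (𝓝 w)

variable {l : Filter α} {h : α → X ≃ₜ X}

theorem TendstoIdOffSingular.symm (hh : TendstoIdOffSingular l h) :
    TendstoIdOffSingular l (fun n => (h n).symm) :=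
  fun w hw => (hh w hw).symm

theorem TendstoIdOffSingular.tendsto (hh : TendstoIdOffSingular l h) {w : X}
    (hw : w ∉ singularPart X) {x : α → X} (hx : Tendsto x l (𝓝 w)) :
    Tendsto (fun n => h n (x n)) l (𝓝 w) :=
  (hh w hw).1.comp (tendsto_id.prodMk hx)

variable [CompactSpace X] [T2Space X] [NeBot l]

/-- Points close to `P` that are connected, inside a neighborhood of `P`, to a finite set of
one-manifold points cannot be moved close to `Q`. -/
theorem TendstoIdOffSingular.false_of_finite_anchors (hh : TendstoIdOffSingular l h)
    {P Q : Set X} (hP : IsClosed P) (hQ : IsClosed Q) (hPQ : Disjoint P Q)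
    (hC : singularPart X ⊆ P ∪ Q) {x : α → X} {b : X} (hb : b ∈ Q)
    (hhx : Tendsto (fun n => h n (x n)) l (𝓝 b))
    (hZ : ∀ V : Set X, IsOpen V → P ⊆ V → Disjoint (closure V) Q → (frontier V).Finite →
      Disjoint (frontier V) (singularPart X) → ∃ Z : Set X, Z.Finite ∧
        Disjoint Z (singularPart X) ∧ ∀ᶠ n in l, ∃ D : Set X, IsPreconnected D ∧ x n ∈ D ∧
          D ⊆ closure V ∧ (D ∩ Z).Nonempty) : False := by
  obtain ⟨V₁, hV₁, hPV₁, hV₁Q, hV₁f⟩ := exists_isOpen_finite_frontier hP hQ hPQ hC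
  obtain ⟨Z, hZfin, hZC, hZD⟩ :=
    hZ V₁ hV₁ hPV₁ hV₁Q hV₁f (disjoint_frontier_of_subset hV₁ hPV₁ hV₁Q hC)
  have hC' : singularPart X ⊆ closure V₁ ∪ Q :=
    hC.trans (union_subset_union_left _ (hPV₁.trans subset_closure))
  -- The second, larger neighborhood leaves room for small displacements: `frontier V` pulls back
  -- off `closure V₁`, and anchors in `closure V₁` map into `V`.
  obtain ⟨V, hV, hV₁V, hVQ, hVf⟩ := exists_isOpen_finite_frontier isClosed_closure hQ hV₁Q hC'
  have hVC := disjoint_frontier_of_subset hV hV₁V hVQ hC'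
  have e1 : ∀ᶠ n in l, ∀ w ∈ frontier V, (h n).symm w ∉ closure V₁ := by
    rw [eventually_all_finite hVf]
    intro w hw
    refine (hh.symm.tendsto (disjoint_left.1 hVC hw) tendsto_const_nhds).eventually
      (isClosed_closure.isOpen_compl.mem_nhds fun hwV => ?_)
    rw [hV.frontier_eq] at hw
    exact hw.2 (hV₁V hwV)
  have e2 : ∀ᶠ n in l, ∀ z ∈ Z, z ∈ closure V₁ → h n z ∈ V := by
    rw [eventually_all_finite hZfin]
    intro z hz
    by_cases hzV : z ∈ closure V₁
    · filter_upwards [(hh.tendsto (disjoint_left.1 hZC hz) tendsto_const_nhds).eventually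
        (hV.mem_nhds (hV₁V hzV))] with n hn _
      exact hn
    · exact Eventually.of_forall fun n hn => (hzV hn).elim
  have e3 : ∀ᶠ n in l, h n (x n) ∉ closure V :=
    hhx.eventually (isClosed_closure.isOpen_compl.mem_nhds fun hbV => disjoint_left.1 hVQ hbV hb)
  obtain ⟨n, h1, h2, h3, D, hD, hxD, hDV, z, hzD, hzZ⟩ := (e1.and (e2.and (e3.and hZD))).exists
  have hsub : h n '' D ⊆ V := by
    refine (hD.image _ (h n).continuous.continuousOn).subset_of_closure_inter_subset hV
      ⟨h n z, ⟨z, hzD, rfl⟩, h2 z hzZ (hDV hzD)⟩ ?_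
    rintro _ ⟨hw, d, hd, rfl⟩
    by_contra hn
    exact h1 (h n d) (hV.frontier_eq ▸ ⟨hw, hn⟩) (by simpa using hDV hd)
  exact h3 (subset_closure (hsub ⟨x n, hxD, rfl⟩))

/-- Boundary bumping takes place in the complement of `S_X`. A component that never reaches the
frontier is one of finitely many, and one chosen point of `O_X` in each, where there is one, serves
as anchor. -/
theorem TendstoIdOffSingular.false_of_finite_components (hh : TendstoIdOffSingular l h)
    (hfin : Finite (ConnectedComponents ((circlePart X)ᶜ : Set X)))
    {P Q : Set X} (hP : IsClosed P) (hQ : IsClosed Q) (hPQ : Disjoint P Q)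
    (hC : singularPart X ⊆ P ∪ Q) {x : α → X} {a b : X} (ha : a ∈ P) (hb : b ∈ Q)
    (hx : Tendsto x l (𝓝 a)) (hhx : Tendsto (fun n => h n (x n)) l (𝓝 b))
    (hxO : ∀ n, x n ∈ oneManifoldPart X) (hxS : ∀ᶠ n in l, x n ∉ circlePart X) : False := by
  refine hh.false_of_finite_anchors hP hQ hPQ hC hb hhx ?_
  intro V hV hPV hVQ hVf hVC
  have : CompactSpace ((circlePart X)ᶜ : Set X) :=
    isCompact_iff_compactSpace.1 isOpen_circlePart.isClosed_compl.isCompact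
  have hz : ∀ k : ConnectedComponents ((circlePart X)ᶜ : Set X), ∃ Z : Set X, Z.Finite ∧
      Disjoint Z (singularPart X) ∧ ∀ q : ((circlePart X)ᶜ : Set X),
        ConnectedComponents.mk q = k → (q : X) ∈ oneManifoldPart X →
          ∃ z : ((circlePart X)ᶜ : Set X), ConnectedComponents.mk z = k ∧ (z : X) ∈ Z := by
    intro k
    by_cases hk : ∃ q : ((circlePart X)ᶜ : Set X),
      ConnectedComponents.mk q = k ∧ (q : X) ∈ oneManifoldPart X
    · obtain ⟨z, hzk, hzO⟩ := hk
      exact ⟨{(z : X)}, finite_singleton _, disjoint_singleton_left.2 fun hn => hn hzO,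
        fun q _ _ => ⟨z, hzk, rfl⟩⟩
    · exact ⟨∅, finite_empty, empty_disjoint _, fun q h1 h2 => (hk ⟨q, h1, h2⟩).elim⟩
  choose Z hZf hZC hZ using hz
  refine ⟨frontier V ∪ ⋃ k, Z k, hVf.union (finite_iUnion hZf),
    hVC.union_left (disjoint_iUnion_left.2 hZC), ?_⟩
  filter_upwards [hxS, hx.eventually (hV.mem_nhds (hPV ha))] with n hnS hnV
  rcases exists_preconnected_meets_frontier_or_component_subset
    (hV.preimage (continuous_subtype_val (p := fun y => y ∈ (circlePart X)ᶜ)))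
    (x := ⟨x n, hnS⟩) hnV with ⟨D, hD, hxD, hDV, z, hzD, hzf⟩ | hcomp
  · refine ⟨Subtype.val '' D, hD.image _ continuous_subtype_val.continuousOn, ⟨_, hxD, rfl⟩, ?_,
      z, ⟨z, hzD, rfl⟩, Or.inl (continuous_subtype_val.frontier_preimage_subset V hzf)⟩
    rintro _ ⟨d, hd, rfl⟩
    exact continuous_subtype_val.closure_preimage_subset V (hDV hd)
  · obtain ⟨z, hzk, hzZ⟩ := hZ _ ⟨x n, hnS⟩ rfl (hxO n)
    refine ⟨Subtype.val '' connectedComponent ⟨x n, hnS⟩,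
      isPreconnected_connectedComponent.image _ continuous_subtype_val.continuousOn,
      ⟨_, mem_connectedComponent, rfl⟩, ?_, z, ⟨z, ?_, rfl⟩, Or.inr (mem_iUnion.2 ⟨_, hzZ⟩)⟩
    · rintro _ ⟨d, hd, rfl⟩
      exact subset_closure (hcomp hd)
    · rw [← ConnectedComponents.coe_eq_coe.1 hzk]
      exact mem_connectedComponent

/-- Near the isolated point `a`, a component missing the frontier either is the component of `a`,
for which one anchor suffices, or avoids `C` and is a circle. -/
theorem TendstoIdOffSingular.false_of_isolated (hh : TendstoIdOffSingular l h) {a b : X}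
    (ha : IsClosed (singularPart X \ {a})) (hb : b ∈ singularPart X) (hab : a ≠ b)
    {x : α → X} (hx : Tendsto x l (𝓝 a)) (hhx : Tendsto (fun n => h n (x n)) l (𝓝 b))
    (hxO : ∀ n, x n ∈ oneManifoldPart X) (hxS : ∀ᶠ n in l, x n ∉ circlePart X) : False := by
  refine hh.false_of_finite_anchors (P := {a}) isClosed_singleton ha
    disjoint_sdiff_right (by rw [union_sdiff_self]; exact subset_union_right)
    ⟨hb, hab.symm⟩ hhx ?_
  intro V hV haV hVQ hVf hVC
  obtain ⟨Z, hZf, hZC, hZ⟩ : ∃ Z : Set X, Z.Finite ∧ Disjoint Z (singularPart X) ∧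
      ((connectedComponent a ∩ oneManifoldPart X).Nonempty →
        (connectedComponent a ∩ Z).Nonempty) := by
    by_cases hne : (connectedComponent a ∩ oneManifoldPart X).Nonempty
    · obtain ⟨z, hz, hzO⟩ := hne
      exact ⟨{z}, finite_singleton _, disjoint_singleton_left.2 fun hn => hn hzO,
        fun _ => ⟨z, hz, rfl⟩⟩
    · exact ⟨∅, finite_empty, empty_disjoint _, fun h => (hne h).elim⟩
  refine ⟨frontier V ∪ Z, hVf.union hZf, hVC.union_left hZC, ?_⟩
  filter_upwards [hxS, hx.eventually (hV.mem_nhds (haV rfl))] with n hnS hnV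
  rcases exists_preconnected_meets_frontier_or_component_subset hV hnV with
    ⟨D, hD, hxD, hDV, z, hzD, hzf⟩ | hcomp
  · exact ⟨D, hD, hxD, hDV, z, hzD, Or.inl hzf⟩
  · by_cases hac : a ∈ connectedComponent (x n)
    · have heq := connectedComponent_eq hac
      obtain ⟨z, hz, hzZ⟩ := hZ ⟨x n, heq ▸ mem_connectedComponent, hxO n⟩
      exact ⟨connectedComponent (x n), isPreconnected_connectedComponent, mem_connectedComponent,
        hcomp.trans subset_closure, z, heq ▸ hz, Or.inr hzZ⟩
    · refine (hnS (mem_circlePart_of_component_subset fun w hw => ?_)).elim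
      by_contra hn
      refine disjoint_left.1 hVQ (subset_closure (hcomp hw)) ⟨hn, ?_⟩
      rintro rfl
      exact hac hw

end Convergence

/-! ### Splitting the singular part -/

/-- Distinct points of a closed zero-dimensional set lie in complementary closed parts of it. -/
theorem IsZeroDimensional.exists_closed_partition {X : Type*} [TopologicalSpace X] [T1Space X]
    {C : Set X} (hC : IsClosed C) (hz : IsZeroDimensional C) {a b : X} (ha : a ∈ C) (hb : b ∈ C)
    (hab : a ≠ b) :
    ∃ P Q : Set X, IsClosed P ∧ IsClosed Q ∧ Disjoint P Q ∧ C ⊆ P ∪ Q ∧ a ∈ P ∧ b ∈ Q := by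
  obtain ⟨E, hE, haE, hsub⟩ := TopologicalSpace.IsTopologicalBasis.exists_subset_of_mem_open hz
    (a := ⟨a, ha⟩) (u := {⟨b, hb⟩}ᶜ) (by simpa using hab) isOpen_compl_singleton
  refine ⟨Subtype.val '' E, Subtype.val '' Eᶜ, hC.isClosedMap_subtype_val _ hE.1,
    hC.isClosedMap_subtype_val _ hE.compl.1, ?_, ?_, ⟨_, haE, rfl⟩,
    ⟨⟨b, hb⟩, fun hbE => hsub hbE rfl, rfl⟩⟩
  · exact (disjoint_image_iff Subtype.val_injective).2 disjoint_compl_right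
  · rw [← image_union, union_compl_self, image_univ, Subtype.range_coe]

/-- Among two distinct points of a convergent sequence, one is isolated. -/
theorem IsConvergentSequence.isClosed_sdiff_or {X : Type*} [TopologicalSpace X] [T2Space X]
    {C : Set X} (hC : IsConvergentSequence C) {a b : X} (ha : a ∈ C) (hb : b ∈ C) (hab : a ≠ b) :
    IsClosed (C \ {a}) ∨ IsClosed (C \ {b}) := by
  obtain ⟨c, u, hu, hcu, hlim, rfl⟩ := hC
  have key : ∀ k, IsClosed (insert c (range u) \ {u k}) := by
    intro k
    -- Overwriting the deleted term by the limit keeps a convergent sequence, whose range with its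
    -- limit is compact.
    let v : ℕ → X := fun j => if j = k then c else u j
    have hv : Tendsto v atTop (𝓝 c) := by
      refine hlim.congr' ?_
      filter_upwards [eventually_gt_atTop k] with j hj
      simp [v, hj.ne']
    have : insert c (range u) \ {u k} = insert c (range v) := by
      ext x
      constructor
      · rintro ⟨rfl | ⟨j, rfl⟩, hx⟩
        · exact mem_insert _ _
        · refine Or.inr ⟨j, ?_⟩
          have : j ≠ k := by rintro rfl; exact hx rfl
          simp [v, this]
      · have hck : c ≠ u k := fun h => hcu ⟨k, h.symm⟩
        rintro (rfl | ⟨j, rfl⟩)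
        · exact ⟨mem_insert _ _, hck⟩
        · by_cases hj : j = k
          · simpa [v, hj] using hck
          · refine ⟨Or.inr ⟨j, by simp [v, hj]⟩, ?_⟩
            simpa [v, hj] using fun h => hj (hu h)
    rw [this]
    exact hv.isCompact_insert_range.isClosed
  rcases ha with rfl | ⟨k, rfl⟩
  · rcases hb with rfl | ⟨k, rfl⟩
    · exact (hab rfl).elim
    · exact Or.inr (key k)
  · exact Or.inl (key k)

/-! ### Shrunk balls against uniform closeness -/

section Metric

variable {X : Type*} [MetricSpace X]

theorem shrunkBall_mono {C : Set X} {ε ε' : ℝ} (h : ε ≤ ε') : shrunkBall C ε ⊆ shrunkBall C ε' :=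
  fun _ hf x hx => (hf x fun hx' => hx (Metric.thickening_mono h C hx')).imp
    (fun h1 => h1.trans_le h) (fun h1 => h1.trans_le h)

theorem inv_mem_shrunkBall {C : Set X} {ε : ℝ} {f : X ≃ₜ X} (hf : f ∈ shrunkBall C ε) :
    f.symm ∈ shrunkBall C ε :=
  fun x hx => (hf x hx).symm

theorem one_mem_shrunkBall {C : Set X} {ε : ℝ} (hε : 0 < ε) : (1 : X ≃ₜ X) ∈ shrunkBall C ε :=
  fun x _ => ⟨by simpa using hε, by change dist x x < ε; simpa using hε⟩

theorem tendstoIdOffSingular_of_mem_shrunkBall {α : Type*} {l : Filter α} {h : α → X ≃ₜ X}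
    (hh : ∀ ε > 0, ∀ᶠ n in l, h n ∈ shrunkBall (singularPart X) ε) : TendstoIdOffSingular l h := by
  have key : ∀ h : α → X ≃ₜ X, (∀ ε > 0, ∀ᶠ n in l, h n ∈ shrunkBall (singularPart X) ε) →
      ∀ w ∉ singularPart X, Tendsto (fun q : α × X => h q.1 q.2) (l ×ˢ 𝓝 w) (𝓝 w) := by
    intro h hh w hw
    obtain ⟨r, hr, hball⟩ := Metric.isOpen_iff.1 isClosed_singularPart.isOpen_compl w hw
    rw [Metric.tendsto_nhds]
    intro η hη
    have hr2 : 0 < min (r / 2) (η / 2) := lt_min (by linarith) (by linarith)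
    filter_upwards [prod_mem_prod (hh _ hr2) (Metric.ball_mem_nhds w hr2)]
    rintro ⟨n, x⟩ ⟨hn, hx⟩
    have hxw : dist x w < min (r / 2) (η / 2) := hx
    have hd := (hn x ?_).1
    · calc dist (h n x) w ≤ dist (h n x) x + dist x w := dist_triangle _ _ _
        _ < η := by linarith [min_le_right (r / 2) (η / 2)]
    · intro hxt
      obtain ⟨c, hc, hxc⟩ := Metric.mem_thickening_iff.1 hxt
      refine hball (a := c) ?_ hc
      rw [Metric.mem_ball]
      linarith [dist_triangle_left c w x, min_le_left (r / 2) (η / 2)]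
  exact fun w hw => ⟨key h hh w hw, key (fun n => (h n).symm)
    (fun ε hε => (hh ε hε).mono fun n hn => inv_mem_shrunkBall hn) w hw⟩

variable [CompactSpace X]

/-- Under the hypotheses of the main theorem, homeomorphisms close to the identity away from the
singular part are uniformly close to the identity. -/
theorem exists_shrunkBall_forall_dist_lt (hdense : Dense (oneManifoldPart X))
    (hlim : (closure (circlePart X) ∩ singularPart X).Subsingleton)
    (hcase : (IsZeroDimensional (singularPart X) ∧
        Finite (ConnectedComponents ((circlePart X)ᶜ : Set X))) ∨
      IsConvergentSequence (singularPart X)) {δ : ℝ} (hδ : 0 < δ) :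
    ∃ ε > 0, ∀ h ∈ shrunkBall (singularPart X) ε, ∀ x, dist (h x) x < δ := by
  by_contra! hcon
  -- Density moves the badly displaced point into `O_X`, at the cost of replacing `δ` by `δ / 2`.
  have hseq : ∀ n : ℕ, ∃ h ∈ shrunkBall (singularPart X) (1 / ((n : ℝ) + 1)),
      ∃ x ∈ oneManifoldPart X, δ / 2 < dist (h x) x := by
    intro n
    obtain ⟨h, hh, x, hx⟩ := hcon _ (Nat.one_div_pos_of_nat (n := n))
    obtain ⟨z, hz, hzO⟩ := hdense.inter_open_nonempty {x | δ / 2 < dist (h x) x}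
      (isOpen_lt continuous_const (h.continuous.dist continuous_id))
      ⟨x, (half_lt_self hδ).trans_le hx⟩
    exact ⟨h, hh, z, hzO, hz⟩
  choose h hh x hxO hxd using hseq
  let l : Ultrafilter ℕ := hyperfilter ℕ
  have hl : (l : Filter ℕ) ≤ atTop := Nat.hyperfilter_le_atTop
  have htend : TendstoIdOffSingular (l : Filter ℕ) h := by
    refine tendstoIdOffSingular_of_mem_shrunkBall fun ε hε => hl ?_
    filter_upwards [(tendsto_one_div_add_atTop_nhds_zero_nat (𝕜 := ℝ)).eventually_lt_const hε]
      with n hn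
    exact shrunkBall_mono hn.le (hh n)
  have hlimit : ∀ z : ℕ → X, ∃ a, Tendsto z l (𝓝 a) := by
    intro z
    obtain ⟨a, -, ha⟩ := isCompact_univ.ultrafilter_le_nhds (l.map z) (by simp)
    exact ⟨a, ha⟩
  obtain ⟨a, ha⟩ := hlimit x
  obtain ⟨b, hb⟩ := hlimit fun n => h n (x n)
  have hab : a ≠ b := by
    rintro rfl
    have := ge_of_tendsto (hb.dist ha) (Eventually.of_forall fun n => (hxd n).le)
    rw [dist_self] at this
    linarith
  have haC : a ∈ singularPart X := by
    by_contra hn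
    exact hab (tendsto_nhds_unique (htend.tendsto hn ha) hb)
  have hback : Tendsto (fun n => (h n).symm (h n (x n))) l (𝓝 a) := by simpa using ha
  have hbC : b ∈ singularPart X := by
    by_contra hn
    exact hab (tendsto_nhds_unique hback (htend.symm.tendsto hn hb))
  -- Otherwise, along the ultrafilter, `x n` and `h n (x n)` both lie in the invariant set `S_X`,
  -- making `a` and `b` two limit points of it in `C`.
  have hxS : ∀ᶠ n in (l : Filter ℕ), x n ∉ circlePart X := by
    rw [Ultrafilter.eventually_not]
    intro hS
    refine hab (hlim ⟨mem_closure_of_tendsto ha hS, haC⟩ ⟨mem_closure_of_tendsto hb ?_, hbC⟩)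
    exact hS.mono fun n hn => apply_mem_circlePart (h n) hn
  rcases hcase with ⟨hzero, hfin⟩ | hconv
  · obtain ⟨P, Q, hP, hQ, hPQ, hCPQ, haP, hbQ⟩ :=
      hzero.exists_closed_partition isClosed_singularPart haC hbC hab
    exact htend.false_of_finite_components hfin hP hQ hPQ hCPQ haP hbQ ha hb hxO hxS
  · rcases hconv.isClosed_sdiff_or haC hbC hab with hcl | hcl
    · exact htend.false_of_isolated hcl hbC hab ha hb hxO hxS
    -- When `b` is the isolated point, the inverses carry `h n (x n)` back to `x n`, exchanging the
    -- roles of `a` and `b`.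
    · refine htend.symm.false_of_isolated hcl haC hab.symm hb hback
        (fun n => apply_mem_oneManifoldPart (h n) (hxO n)) (hxS.mono fun n hn hS => hn ?_)
      simpa using apply_mem_circlePart (h n).symm hS

/-- Evaluation is jointly continuous and the complement of `C_ε` is compact; the condition on
inverses follows by continuity of inversion. -/
theorem isOpen_shrunkBall (C : Set X) (ε : ℝ) : IsOpen[compactOpenTopology X] (shrunkBall C ε) := by
  let _ := compactOpenTopology X
  have : IsTopologicalGroup (X ≃ₜ X) := isHausdorffGroupTopology_compactOpenTopology.1
  have hc : Continuous (fun h : X ≃ₜ X => (h : C(X, X))) := continuous_induced_dom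
  have hK : IsCompact (Metric.thickening ε C)ᶜ := Metric.isOpen_thickening.isClosed_compl.isCompact
  have h1 : IsOpen {h : X ≃ₜ X | ∀ x ∈ (Metric.thickening ε C)ᶜ, dist (h x) x < ε} := by
    rw [isOpen_iff_mem_nhds]
    intro h hh
    refine hK.eventually_forall_of_forall_eventually fun x hx => ?_
    have hev : Continuous fun q : (X ≃ₜ X) × X => dist (q.1 q.2) q.2 :=
      (continuous_eval.comp (hc.prodMap continuous_id)).dist continuous_snd
    exact hev.continuousAt.eventually_lt_const (hh x hx)
  have h2 := h1.preimage (continuous_inv (G := X ≃ₜ X))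
  convert h1.inter h2 using 1
  ext h
  exact ⟨fun hh => ⟨fun x hx => (hh x hx).1, fun x hx => (hh x hx).2⟩,
    fun hh x hx => ⟨hh.1 x hx, hh.2 x hx⟩⟩

theorem exists_forall_dist_lt_subset_of_mem_nhds {U : Set (X ≃ₜ X)}
    (hU : U ∈ @nhds _ (compactOpenTopology X) 1) :
    ∃ δ > 0, {h : X ≃ₜ X | ∀ x, dist (h x) x < δ} ⊆ U := by
  rw [nhds_induced, mem_comap] at hU
  obtain ⟨W, hW, hWU⟩ := hU
  obtain ⟨δ, hδ, hball⟩ := Metric.mem_nhds_iff.1 hW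
  refine ⟨δ, hδ, fun h hh => hWU (hball ?_)⟩
  rw [Metric.mem_ball, ContinuousMap.dist_lt_iff hδ]
  exact hh

end Metric

/-! ### Translation to the identity and the main theorem -/

section Groups

variable {G : Type*} [Group G]

theorem preimage_mul_left_mem_nhds_one_iff [TopologicalSpace G] [IsTopologicalGroup G] {g : G}
    {U : Set G} : (fun x => g * x) ⁻¹' U ∈ 𝓝 (1 : G) ↔ U ∈ 𝓝 g := by
  rw [← map_mul_left_nhds_one g, mem_map]

theorem IsMinimumGroupTopology.isMinimalGroupTopology {t : TopologicalSpace G}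
    (ht : IsMinimumGroupTopology t) : IsMinimalGroupTopology t :=
  ⟨ht.1, fun s hs hst => hst.2 (ht.2 s hs)⟩

end Groups

end HomeoTop

theorem mainTheorem9 {X : Type*} [MetricSpace X] [CompactSpace X]
    (hdense : Dense (HomeoTop.oneManifoldPart X))
    (hlim : (closure (HomeoTop.circlePart X) ∩ HomeoTop.singularPart X).Subsingleton)
    (hcase :
      (HomeoTop.IsZeroDimensional (HomeoTop.singularPart X) ∧
        Finite (ConnectedComponents ((HomeoTop.circlePart X)ᶜ : Set X))) ∨
      HomeoTop.IsConvergentSequence (HomeoTop.singularPart X)) :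
    HomeoTop.shrunkOpens (HomeoTop.singularPart X) =
        {U : Set (X ≃ₜ X) | IsOpen[HomeoTop.compactOpenTopology X] U} ∧
      HomeoTop.IsMinimumGroupTopology (HomeoTop.compactOpenTopology X) ∧
      HomeoTop.IsMinimalGroupTopology (HomeoTop.compactOpenTopology X) := by
  have hk := HomeoTop.isHausdorffGroupTopology_compactOpenTopology (X := X)
  have hbase : ∀ U : Set (X ≃ₜ X), IsOpen[HomeoTop.compactOpenTopology X] U → ∀ f ∈ U,
      ∃ ε > 0, HomeoTop.shrunkBall (HomeoTop.singularPart X) ε ⊆ (fun g => f * g) ⁻¹' U := by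
    let _ := HomeoTop.compactOpenTopology X
    have := hk.1
    intro U hU f hf
    obtain ⟨δ, hδ, hsub⟩ := HomeoTop.exists_forall_dist_lt_subset_of_mem_nhds
      (HomeoTop.preimage_mul_left_mem_nhds_one_iff.2 (hU.mem_nhds hf))
    obtain ⟨ε, hε, h⟩ := HomeoTop.exists_shrunkBall_forall_dist_lt hdense hlim hcase hδ
    exact ⟨ε, hε, fun g hg => hsub (h g hg)⟩
  have hmin : HomeoTop.IsMinimumGroupTopology (HomeoTop.compactOpenTopology X) := by
    refine ⟨hk, fun s hs U hU => ?_⟩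
    have := hs.1
    have := hs.2
    refine isOpen_iff_mem_nhds.2 fun f hf => ?_
    obtain ⟨ε, hε, hsub⟩ := hbase U hU f hf
    exact HomeoTop.preimage_mul_left_mem_nhds_one_iff.1
      (mem_of_superset (HomeoTop.shrunkBall_mem_nhds hε) hsub)
  refine ⟨?_, hmin, hmin.isMinimalGroupTopology⟩
  let _ := HomeoTop.compactOpenTopology X
  have := hk.1
  refine Subset.antisymm ?_ ?_
  · rintro _ ⟨𝒮, h𝒮, rfl⟩
    change IsOpen (⋃₀ 𝒮)
    refine isOpen_sUnion fun V hV => ?_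
    obtain ⟨f, ε, -, rfl⟩ := h𝒮 V hV
    exact isOpenMap_mul_left f _ (HomeoTop.isOpen_shrunkBall _ ε)
  · intro U hU
    refine ⟨{V | (∃ (f : X ≃ₜ X) (ε : ℝ), 0 < ε ∧
      V = (fun g => f * g) '' HomeoTop.shrunkBall (HomeoTop.singularPart X) ε) ∧ V ⊆ U},
      fun V hV => hV.1, Subset.antisymm (fun f hf => ?_) (sUnion_subset fun V hV => hV.2)⟩
    obtain ⟨ε, hε, hsub⟩ := hbase U hU f hf
    exact ⟨_, ⟨⟨f, ε, hε, rfl⟩, image_subset_iff.2 hsub⟩, 1, HomeoTop.one_mem_shrunkBall hε,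
      mul_one f⟩
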